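/- Let $\delta>0$. Then there are real numbers $C>0$ and $\epsilon>0$, depending only on $\delta$, such that the following holds. Let $q=p^{\alpha}$ be a power of a prime $p$, let $a_1,a_2\in\mathbb{F}_q^*$, and let $A\subset\mathbb{F}_q^*$ satisfy $C<|A|<p^{1-\delta}$. Write $$A_{20}=\{g_1g_2\cdots g_{20} : g_i\in A\cup A^{-1}\cup\{1\}\},\qquad A^{-1}=\{g^{-1}:g\in A\},$$ for the set of all products of at most $20$ elements of $A\cup A^{-1}$. Then $$\left|\left\{a_1\left(xy+x^{-1}y^{-1}\right)+a_2\left(x^{-1}y+xy^{-1}\right) : x,y\in A_{20}\right\}\right|>|A|^{1+\epsilon}.$$ -/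

import Mathlib

open scoped Pointwise

/-- For a subset `A` of a group and a natural number `r`, the set `A_r` of all products
`g₁ * g₂ * ⋯ * g_r` with every `g_i` in `A ∪ A⁻¹ ∪ {1}`, that is, the set of all products
of at most `r` elements of `A ∪ A⁻¹`. -/
def boundedProducts {G : Type*} [Group G] (A : Set G) (r : ℕ) : Set G :=
  {g | ∃ f : Fin r → G, (∀ i, f i ∈ A ∪ A⁻¹ ∪ {1}) ∧ (List.ofFn f).prod = g}

/-- The set `A_r` is the `r`-fold pointwise product of `A ∪ A⁻¹ ∪ {1}` with itself. -/
theorem boundedProducts_eq_pow {G : Type*} [Group G] (A : Set G) (r : ℕ) :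
    boundedProducts A r = (A ∪ A⁻¹ ∪ {1}) ^ r := by
  ext g
  rw [Set.mem_pow]
  constructor
  · rintro ⟨f, hf, rfl⟩
    exact ⟨fun i => ⟨f i, hf i⟩, rfl⟩
  · rintro ⟨f, rfl⟩
    exact ⟨fun i => f i, fun i => (f i).2, rfl⟩

/-! Let `f u = u² + u⁻²`. Putting `x = u * v⁻¹`, `y = u * v` shows that the set contains `a₁ * f u +
a₂ * f v` for all `u`, `v` in the tenfold product set, so it contains a sum of two dilates of `W`,
the image of that set under `f`. The identity `f u * f v = f (u * v) + f (u * v⁻¹)` puts the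
products of elements of `X = f(A)` in `W + W`. If the sum of dilates were small, Plünnecke–Ruzsa
would make `6 • W - 6 • W` small; but this contains the quadratic expressions that the sum-product
estimate `exists_card_image_dilates_ge` shows to be large. -/

open Finset

/-- Cauchy–Schwarz: a map with few collisions has a large image. -/
theorem card_sq_le_card_image_mul_card_collisions {α β : Type*} [DecidableEq β]
    (s : Finset α) (f : α → β) :
    #s ^ 2 ≤ #(s.image f) * #{z ∈ s ×ˢ s | f z.1 = f z.2} := by
  classical
  have h1 : #s = ∑ b ∈ s.image f, #{a ∈ s | f a = b} :=
    card_eq_sum_card_fiberwise fun a ha => mem_image_of_mem f ha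
  have h2 : #{z ∈ s ×ˢ s | f z.1 = f z.2} = ∑ b ∈ s.image f, #{a ∈ s | f a = b} ^ 2 := by
    rw [card_eq_sum_card_fiberwise (f := fun z : α × α => f z.1) (t := s.image f)]
    · refine sum_congr rfl fun b _ => ?_
      rw [sq, ← card_product]
      congr 1
      ext ⟨x, y⟩
      simp only [mem_filter, mem_product]
      constructor
      · rintro ⟨⟨⟨hx, hy⟩, h⟩, rfl⟩
        exact ⟨⟨hx, rfl⟩, hy, h.symm⟩
      · rintro ⟨⟨hx, rfl⟩, hy, h⟩
        exact ⟨⟨⟨hx, hy⟩, h.symm⟩, rfl⟩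
    · intro z hz
      exact mem_image_of_mem f (mem_product.1 (mem_filter.1 (mem_coe.1 hz)).1).1
  rw [h2]
  conv_lhs => rw [h1]
  exact sq_sum_le_card_mul_sum_sq

/-- Some dilate `n • X` with `n` in the prime field makes `X + n • X` large. -/
theorem exists_natCast_card_image_add_mul_ge {F : Type*} [Field F] [DecidableEq F] {p : ℕ}
    [CharP F p] (hp : 0 < p) (X : Finset F) :
    ∃ n : ℕ, p * #X ^ 2 ≤
      #((X ×ˢ X).image fun z : F × F => z.1 + (n : F) * z.2) * (p + #X ^ 2) := by
  set P := X ×ˢ X with hP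
  have hPc : #P = #X ^ 2 := by rw [hP, card_product, sq]
  let f : ℕ → F × F → F := fun n z => z.1 + (n : F) * z.2
  let E : ℕ → ℕ := fun n => #{z ∈ P ×ˢ P | f n z.1 = f n z.2}
  -- A collision between distinct pairs determines `n` modulo `p`.
  have hfib : ∀ z ∈ P ×ˢ P, #{n ∈ range p | f n z.1 = f n z.2} ≤
      (if z.1 = z.2 then p else 0) + 1 := by
    rintro ⟨⟨a, b⟩, ⟨c, d⟩⟩ -
    split_ifs with h
    · exact (card_filter_le _ _).trans (by simp)
    · rw [zero_add, card_le_one]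
      intro m hm n hn
      simp only [mem_filter, mem_range, f] at hm hn
      have hbd : b - d ≠ 0 := by
        intro hbd
        obtain rfl : b = d := sub_eq_zero.1 hbd
        exact h (by simpa using hm.2)
      have hmn : (m : F) = n := mul_right_cancel₀ hbd (by linear_combination hm.2 - hn.2)
      have := (CharP.natCast_eq_natCast F p).1 hmn
      exact Nat.ModEq.eq_of_lt_of_lt this hm.1 hn.1
  have hsum : ∑ n ∈ range p, E n ≤ p * #P + #P ^ 2 := by
    calc ∑ n ∈ range p, E n
        = ∑ z ∈ P ×ˢ P, #{n ∈ range p | f n z.1 = f n z.2} :=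
          sum_card_bipartiteAbove_eq_sum_card_bipartiteBelow
            (fun (n : ℕ) (z : (F × F) × F × F) => f n z.1 = f n z.2)
      _ ≤ ∑ z ∈ P ×ˢ P, ((if z.1 = z.2 then p else 0) + 1) := sum_le_sum hfib
      _ = p * #P + #P ^ 2 := by
          rw [sum_add_distrib, sum_product]
          simp [sq, mul_comm]
  obtain ⟨n, -, hn⟩ : ∃ n ∈ range p, p * E n ≤ p * #P + #P ^ 2 := by
    by_contra! hcon
    have h := sum_lt_sum_of_nonempty (nonempty_range_iff.2 hp.ne') hcon
    rw [sum_const, card_range, smul_eq_mul, ← mul_sum] at h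
    exact absurd (lt_of_mul_lt_mul_left h (Nat.zero_le p)) (not_lt.2 hsum)
  refine ⟨n, ?_⟩
  rw [← hPc]
  have hCS := card_sq_le_card_image_mul_card_collisions P (f n)
  rcases Nat.eq_zero_or_pos #P with h0 | h0
  · simp [h0]
  · refine le_of_mul_le_mul_right ?_ h0
    calc p * #P * #P = p * #P ^ 2 := by ring
      _ ≤ p * (#(P.image (f n)) * E n) := Nat.mul_le_mul_left p hCS
      _ = #(P.image (f n)) * (p * E n) := by ring
      _ ≤ #(P.image (f n)) * (p * #P + #P ^ 2) := Nat.mul_le_mul_left _ hn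
      _ = #(P.image (f n)) * (p + #P) * #P := by ring

/-- A quadratic sum-product estimate: some sum of two dilates of `X`, by coefficients that are
short sums of differences of elements of `X`, is large. -/
theorem exists_card_image_dilates_ge {F : Type*} [Field F] [DecidableEq F] {p : ℕ}
    [CharP F p] (hp : 0 < p) (X : Finset F) (hX : 1 < #X) {M : ℝ} (hM : M ≤ p)
    (hMX : M ≤ (#X : ℝ) ^ 2) :
    ∃ a ∈ X, ∃ b ∈ X, ∃ c ∈ X, ∃ d ∈ X, ∃ e : F, (e = 0 ∨ e = c - d) ∧
      M ≤ 2 * #((X ×ˢ X).image fun z : F × F => (c - d) * z.1 + (a - b + e) * z.2) := by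
  let Q : F → Prop := fun ξ => ∃ a ∈ X, ∃ b ∈ X, ∃ c ∈ X, ∃ d ∈ X, c ≠ d ∧ ξ * (c - d) = a - b
  obtain ⟨c₀, hc₀, d₀, hd₀, hcd₀⟩ := one_lt_card.1 hX
  have dilate : ∀ {c d η ξ : F}, c ≠ d → ξ * (c - d) = η →
      #((X ×ˢ X).image fun z : F × F => (c - d) * z.1 + η * z.2) =
        #((X ×ˢ X).image fun z : F × F => z.1 + ξ * z.2) := by
    rintro c d η ξ hcd rfl
    rw [← card_image_of_injective ((X ×ˢ X).image fun z : F × F => z.1 + ξ * z.2)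
      (mul_right_injective₀ (sub_ne_zero.2 hcd)), image_image]
    congr 2
    funext z
    simp only [Function.comp]
    ring
  -- Either the quotients of differences of `X` include the whole prime field, hence the good `n`
  -- found by averaging, or some `ξ + 1` is not such a quotient and `x + (ξ + 1) * y` is injective
  -- on `X ×ˢ X`.
  by_cases hQ : ∀ ξ, Q ξ → Q (ξ + 1)
  · have hnat : ∀ n : ℕ, Q n := by
      intro n
      induction n with
      | zero => exact ⟨c₀, hc₀, c₀, hc₀, c₀, hc₀, d₀, hd₀, hcd₀, by simp⟩
      | succ n ih => simpa using hQ _ ih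
    obtain ⟨n, hn⟩ := exists_natCast_card_image_add_mul_ge hp X
    obtain ⟨a, ha, b, hb, c, hc, d, hd, hcd, h⟩ := hnat n
    refine ⟨a, ha, b, hb, c, hc, d, hd, 0, Or.inl rfl, ?_⟩
    rw [add_zero, dilate hcd h]
    set T := #((X ×ˢ X).image fun z : F × F => z.1 + (n : F) * z.2)
    have hn' : (p : ℝ) * (#X : ℝ) ^ 2 ≤ T * (p + (#X : ℝ) ^ 2) := by exact_mod_cast hn
    have hpos : (0 : ℝ) < p := by exact_mod_cast hp
    have hXpos : (0 : ℝ) < (#X : ℝ) ^ 2 := by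
      have : (0 : ℝ) < #X := by exact_mod_cast (zero_lt_one.trans hX)
      positivity
    have h1 := mul_le_mul_of_nonneg_right hM hXpos.le
    have h2 := mul_le_mul_of_nonneg_right hMX hpos.le
    refine le_of_mul_le_mul_right ?_ (add_pos hpos hXpos)
    linarith
  · push Not at hQ
    obtain ⟨ξ, ⟨a, ha, b, hb, c, hc, d, hd, hcd, h⟩, hξ⟩ := hQ
    refine ⟨a, ha, b, hb, c, hc, d, hd, c - d, Or.inr rfl, ?_⟩
    rw [dilate (ξ := ξ + 1) hcd (by linear_combination h), card_image_of_injOn]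
    · rw [card_product]
      push_cast
      nlinarith [sq_nonneg (#X : ℝ)]
    · rintro ⟨x, y⟩ hxy ⟨x', y'⟩ hxy' hz
      simp only [coe_product, Set.mem_prod, mem_coe] at hxy hxy' hz
      by_cases hy : y = y'
      · subst hy
        simpa using hz
      · exact absurd ⟨x', hxy'.1, x, hxy.1, y, hxy.2, y', hxy'.2, hy,
          by linear_combination hz⟩ hξ

/-- If a sum of dilates of `W` is small and `W` contains `X` and all products of two elements of
`X` are sums of two elements of `W`, then the sum-product estimate bounds its size from below. -/
theorem le_card_dilates_pow_of_mul_subset {F : Type*} [Field F] [DecidableEq F] {p : ℕ}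
    [CharP F p] (hp : 0 < p) (X W : Finset F) (hX : 1 < #X) (hXW : X ⊆ W)
    (hmul : X * X ⊆ W + W) {M : ℝ} (hM : M ≤ p) (hMX : M ≤ (#X : ℝ) ^ 2)
    {a₁ a₂ : F} (h₁ : a₁ ≠ 0) (h₂ : a₂ ≠ 0) :
    M * (#X : ℝ) ^ 11 ≤ 2 * (#(W.image (a₁ * ·) + W.image (a₂ * ·)) : ℝ) ^ 12 := by
  obtain ⟨a, ha, b, hb, c, hc, d, hd, e, he, hT⟩ := exists_card_image_dilates_ge hp X hX hM hMX
  have hWne : W.Nonempty := (card_pos.1 (zero_lt_one.trans hX)).mono hXW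
  have hsub : ((X ×ˢ X).image fun z : F × F => (c - d) * z.1 + (a - b + e) * z.2) ⊆
      (3 • (W + W)) - (3 • (W + W)) := by
    intro z hz
    obtain ⟨⟨x, y⟩, hxy, rfl⟩ := mem_image.1 hz
    rw [mem_product] at hxy
    have key : ∀ {u v : F}, u ∈ X → v ∈ X → u * v ∈ W + W :=
      fun hu hv => hmul (mul_mem_mul hu hv)
    have h3 : ∀ {u v w : F}, u ∈ W + W → v ∈ W + W → w ∈ W + W →
        u + v + w ∈ 3 • (W + W) := by
      intro u v w hu hv hw
      rw [succ_nsmul, two_nsmul]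
      exact add_mem_add (add_mem_add hu hv) hw
    rw [mem_sub]
    -- The expression expands into products, three of each sign; when `e = 0`, the term `c * y` is
    -- added and subtracted as padding.
    rcases he with rfl | rfl
    · exact ⟨_, h3 (key hc hxy.1) (key ha hxy.2) (key hc hxy.2),
        _, h3 (key hd hxy.1) (key hb hxy.2) (key hc hxy.2), by ring⟩
    · exact ⟨_, h3 (key hc hxy.1) (key ha hxy.2) (key hc hxy.2),
        _, h3 (key hd hxy.1) (key hb hxy.2) (key hd hxy.2), by ring⟩
  set U := W.image (a₁ * ·)
  set V := W.image (a₂ * ·)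
  have hU : #U = #W := card_image_of_injective _ (mul_right_injective₀ h₁)
  have hdil : (6 • W - 6 • W).image (a₂ * ·) = 6 • V - 6 • V := by
    have h := image_image₂_distrib (s := 6 • W) (t := 6 • W) (mul_sub a₂)
    have h6 : (6 • W).image (a₂ * ·) = 6 • V := image_nsmul (AddMonoidHom.mulLeft a₂) W 6
    rw [h6] at h
    exact h
  have h36 : (3 • (W + W)) - (3 • (W + W)) = 6 • W - 6 • W := by
    rw [← two_nsmul, ← mul_nsmul]
  have hcard : #(6 • W - 6 • W) = #(6 • V - 6 • V) := by
    rw [← hdil, card_image_of_injective _ (mul_right_injective₀ h₂)]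
  -- The exponent is `6 + 6 = 12`; the remaining factor `#U` leaves `#U ^ 11` to clear.
  have hPR := pluennecke_ruzsa_inequality_nsmul_sub_nsmul_add (hWne.image (a₁ * ·)) V 6 6
  have hPR' : (#(6 • V - 6 • V) : ℝ) ≤ ((#(U + V) : ℝ) / #U) ^ 12 * #U := by
    have h := (NNRat.cast_le (K := ℝ)).2 hPR
    push_cast at h
    exact h
  have hXpos : (0 : ℝ) < #X := by exact_mod_cast zero_lt_one.trans hX
  have hXU : (#X : ℝ) ≤ #U := by rw [hU]; exact_mod_cast card_le_card hXW
  have hUpos : (0 : ℝ) < #U := hXpos.trans_le hXU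
  have hTle := card_le_card hsub
  rw [h36, hcard] at hTle
  have hM2 : M ≤ 2 * (#(6 • V - 6 • V) : ℝ) :=
    hT.trans (mul_le_mul_of_nonneg_left (by exact_mod_cast hTle) zero_le_two)
  calc M * (#X : ℝ) ^ 11 ≤ (2 * (((#(U + V) : ℝ) / #U) ^ 12 * #U)) * (#U : ℝ) ^ 11 := by
        gcongr
        exact hM2.trans (mul_le_mul_of_nonneg_left hPR' zero_le_two)
    _ = 2 * (#(U + V) : ℝ) ^ 12 := by
        field_simp

theorem eq_or_eq_inv_of_add_inv_eq {F : Type*} [Field F] {s t : F} (hs : s ≠ 0) (ht : t ≠ 0)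
    (h : s + s⁻¹ = t + t⁻¹) : s = t ∨ s = t⁻¹ := by
  have : (s - t) * (s * t - 1) = 0 := by
    field_simp at h
    linear_combination h
  rcases mul_eq_zero.1 this with h | h
  · exact Or.inl (sub_eq_zero.1 h)
  · exact Or.inr (eq_inv_of_mul_eq_one_left (sub_eq_zero.1 h))

/-- Each fibre lies in `{v, -v, v⁻¹, -v⁻¹}`. -/
theorem card_le_four_mul_card_image_sq_add_inv_sq {F : Type*} [Field F] [DecidableEq F]
    (A : Finset Fˣ) : #A ≤ 4 * #(A.image fun u : Fˣ => (u : F) ^ 2 + ((u : F) ^ 2)⁻¹) := by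
  refine card_le_mul_card_image A 4 fun z hz => ?_
  obtain ⟨v, -, rfl⟩ := mem_image.1 hz
  refine (card_le_card (t := ({v, -v, v⁻¹, -v⁻¹} : Finset Fˣ)) fun u hu => ?_).trans card_le_four
  have h := (mem_filter.1 hu).2
  have hsq : u ^ 2 = v ^ 2 ∨ u ^ 2 = (v⁻¹) ^ 2 := by
    rcases eq_or_eq_inv_of_add_inv_eq (pow_ne_zero 2 u.ne_zero) (pow_ne_zero 2 v.ne_zero) h
      with h | h
    · exact Or.inl (Units.ext (by simpa using h))
    · exact Or.inr (Units.ext (by simpa using h))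
  simp only [mem_insert, mem_singleton]
  rcases hsq with h | h
  · rcases sq_eq_sq_iff_eq_or_eq_neg.1 (congrArg Units.val h) with h | h
    · exact Or.inl (Units.ext h)
    · exact Or.inr (Or.inl (Units.ext (by simpa using h)))
  · rcases sq_eq_sq_iff_eq_or_eq_neg.1 (congrArg Units.val h) with h | h
    · exact Or.inr (Or.inr (Or.inl (Units.ext h)))
    · exact Or.inr (Or.inr (Or.inr (Units.ext (by simpa using h))))

/-- Growth of the set of traces in polynomial form. -/
theorem le_ncard_trace_set_pow {p α : ℕ} {F : Type*} [Field F] [Finite F] (hp : p.Prime)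
    (hF : Nat.card F = p ^ α) (a₁ a₂ : Fˣ) (A : Set Fˣ) (hA : 4 < A.ncard) {M : ℝ}
    (hM : M ≤ p) (hMA : M ≤ ((A.ncard : ℝ) / 4) ^ 2) (hM0 : 0 ≤ M) :
    M * ((A.ncard : ℝ) / 4) ^ 11 ≤
      2 * ({z : F | ∃ x ∈ boundedProducts A 20, ∃ y ∈ boundedProducts A 20,
            z = (a₁ : F) * ((x : F) * (y : F) + (x : F)⁻¹ * (y : F)⁻¹) +
              (a₂ : F) * ((x : F)⁻¹ * (y : F) + (x : F) * (y : F)⁻¹)}.ncard : ℝ) ^ 12 := by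
  classical
  set S := {z : F | ∃ x ∈ boundedProducts A 20, ∃ y ∈ boundedProducts A 20,
            z = (a₁ : F) * ((x : F) * (y : F) + (x : F)⁻¹ * (y : F)⁻¹) +
              (a₂ : F) * ((x : F)⁻¹ * (y : F) + (x : F) * (y : F)⁻¹)}
  have : Fintype F := Fintype.ofFinite F
  have : Fact p.Prime := ⟨hp⟩
  have : CharP F p := charP_of_card_eq_prime_pow (f := α) (by rw [← hF, Nat.card_eq_fintype_card])
  let f : Fˣ → F := fun u => (u : F) ^ 2 + ((u : F) ^ 2)⁻¹
  let D : Set Fˣ := A ∪ A⁻¹ ∪ {1}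
  have hD1 : (1 : Fˣ) ∈ D := Or.inr rfl
  have hDinv : D⁻¹ = D := by
    simp only [D, Set.union_inv, inv_inv, Set.inv_singleton, inv_one]
    rw [Set.union_comm A⁻¹ A]
  let X : Finset F := A.toFinite.toFinset.image f
  let W : Finset F := (D ^ 10).toFinite.toFinset.image f
  have hAX : #A.toFinite.toFinset ≤ 4 * #X := card_le_four_mul_card_image_sq_add_inv_sq _
  rw [← Set.ncard_eq_toFinset_card] at hAX
  have hA2 : D ^ 2 ⊆ D ^ 10 := Set.pow_subset_pow_right hD1 (by norm_num)
  have hA1 : D ⊆ D ^ 10 := by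
    simpa using Set.pow_subset_pow_right hD1 (show 1 ≤ 10 by norm_num)
  have hAD : A ⊆ D := fun a ha => Or.inl (Or.inl ha)
  have hXW : X ⊆ W := image_subset_image fun a ha => by
    simp only [Set.Finite.mem_toFinset] at ha ⊢
    exact hA1 (hAD ha)
  have hmul : X * X ⊆ W + W := by
    intro z hz
    obtain ⟨x, hx, y, hy, rfl⟩ := mem_mul.1 hz
    obtain ⟨u, hu, rfl⟩ := mem_image.1 hx
    obtain ⟨v, hv, rfl⟩ := mem_image.1 hy
    rw [Set.Finite.mem_toFinset] at hu hv
    have hvinv : v⁻¹ ∈ D := by rw [← hDinv, Set.inv_mem_inv]; exact hAD hv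
    refine mem_add.2 ⟨f (u * v), mem_image_of_mem f ?_, f (u * v⁻¹), mem_image_of_mem f ?_, ?_⟩
    · rw [Set.Finite.mem_toFinset]
      exact hA2 (by rw [sq]; exact Set.mul_mem_mul (hAD hu) (hAD hv))
    · rw [Set.Finite.mem_toFinset]
      exact hA2 (by rw [sq]; exact Set.mul_mem_mul (hAD hu) hvinv)
    · have hu0 := u.ne_zero
      have hv0 := v.ne_zero
      simp only [f, Units.val_mul, Units.val_inv_eq_inv_val]
      field_simp
      ring
  have hsub : ((W.image ((a₁ : F) * ·) + W.image ((a₂ : F) * ·) : Finset F) : Set F) ⊆ S := by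
    intro z hz
    obtain ⟨s, hs, t, ht, rfl⟩ := mem_add.1 (mem_coe.1 hz)
    obtain ⟨s', hs', rfl⟩ := mem_image.1 hs
    obtain ⟨t', ht', rfl⟩ := mem_image.1 ht
    obtain ⟨u, hu, rfl⟩ := mem_image.1 hs'
    obtain ⟨v, hv, rfl⟩ := mem_image.1 ht'
    rw [Set.Finite.mem_toFinset] at hu hv
    have hvinv : v⁻¹ ∈ D ^ 10 := by
      rw [← hDinv, inv_pow, Set.inv_mem_inv]
      exact hv
    -- Here `x * y = u²` and `x⁻¹ * y = v²`; each of `x`, `y` uses `10 + 10` factors.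
    refine ⟨u * v⁻¹, ?_, u * v, ?_, ?_⟩
    · rw [boundedProducts_eq_pow, show 20 = 10 + 10 from rfl, pow_add]
      exact Set.mul_mem_mul hu hvinv
    · rw [boundedProducts_eq_pow, show 20 = 10 + 10 from rfl, pow_add]
      exact Set.mul_mem_mul hu hv
    · have hu0 := u.ne_zero
      have hv0 := v.ne_zero
      simp only [f, Units.val_mul, Units.val_inv_eq_inv_val]
      field_simp
  have hcard : #(W.image ((a₁ : F) * ·) + W.image ((a₂ : F) * ·)) ≤ S.ncard := by
    rw [← Set.ncard_coe_finset]
    exact Set.ncard_le_ncard hsub S.toFinite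
  have hX4 : (A.ncard : ℝ) / 4 ≤ #X := by
    rw [div_le_iff₀ four_pos, mul_comm]
    exact_mod_cast hAX
  have hmain := le_card_dilates_pow_of_mul_subset hp.pos X W (by omega) hXW hmul hM
    (hMA.trans (by gcongr)) a₁.ne_zero a₂.ne_zero
  calc M * ((A.ncard : ℝ) / 4) ^ 11 ≤ M * (#X : ℝ) ^ 11 := by gcongr
    _ ≤ _ := hmain
    _ ≤ 2 * (S.ncard : ℝ) ^ 12 := by gcongr

theorem mainTheorem10 :
    ∀ δ : ℝ, 0 < δ → ∃ C ε : ℝ, 0 < C ∧ 0 < ε ∧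
      ∀ (p α : ℕ) (F : Type*) [Field F] [Finite F], p.Prime → Nat.card F = p ^ α →
      ∀ (a₁ a₂ : Fˣ) (A : Set Fˣ), C < (A.ncard : ℝ) → (A.ncard : ℝ) < (p : ℝ) ^ (1 - δ) →
        (A.ncard : ℝ) ^ (1 + ε) <
          ({z : F | ∃ x ∈ boundedProducts A 20, ∃ y ∈ boundedProducts A 20,
            z = (a₁ : F) * ((x : F) * (y : F) + (x : F)⁻¹ * (y : F)⁻¹) +
              (a₂ : F) * ((x : F)⁻¹ * (y : F) + (x : F) * (y : F)⁻¹)}.ncard : ℝ) := by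
  intro δ₀ hδ₀
  -- Capping at `1` ensures `N ^ (1 + δ) ≤ N ^ 2`.
  set δ := min δ₀ 1
  have hδpos : 0 < δ := lt_min hδ₀ one_pos
  have hδ1 : δ ≤ 1 := min_le_right _ _
  -- With `ε = δ / 24` the 12th power costs only `N ^ (δ / 2)` of the gain `N ^ δ`. The choice of
  -- `C` makes the remaining `N ^ (δ / 2)` exceed `2 ^ 28`, beating the total loss `16 * 4 ^ 11 * 2
  -- = 2 ^ 27`.
  refine ⟨(2 : ℝ) ^ (56 / δ), δ / 24, by positivity, by positivity, ?_⟩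
  intro p α F _ _ hp hF a₁ a₂ A hC hA
  set N : ℝ := (A.ncard : ℝ) with hN
  have hNbig : (2 : ℝ) ^ (56 : ℝ) < N := lt_of_le_of_lt
    (Real.rpow_le_rpow_of_exponent_le one_le_two (by rw [le_div_iff₀ hδpos]; nlinarith)) hC
  have hN4 : 4 < N := lt_trans (by norm_num) hNbig
  have hNpos : 0 < N := by linarith
  have hp1 : (1 : ℝ) ≤ p := by exact_mod_cast hp.one_le
  have hNp : N ^ (1 + δ) ≤ p := by
    have h1 : N ≤ (p : ℝ) ^ (1 - δ) :=
      hA.le.trans (Real.rpow_le_rpow_of_exponent_le hp1 (by linarith [min_le_left δ₀ 1]))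
    calc N ^ (1 + δ) ≤ ((p : ℝ) ^ (1 - δ)) ^ (1 + δ) :=
          Real.rpow_le_rpow hNpos.le h1 (by linarith)
      _ = (p : ℝ) ^ ((1 - δ) * (1 + δ)) := (Real.rpow_mul (by linarith) _ _).symm
      _ ≤ (p : ℝ) ^ (1 : ℝ) := Real.rpow_le_rpow_of_exponent_le hp1 (by nlinarith)
      _ = p := Real.rpow_one _
  have hN2 : N ^ (1 + δ) ≤ N ^ 2 := by
    rw [← Real.rpow_natCast]
    exact Real.rpow_le_rpow_of_exponent_le (by linarith) (by push_cast; linarith)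
  have hpos : 0 < N ^ (1 + δ) := by positivity
  have hgrowth := le_ncard_trace_set_pow hp hF a₁ a₂ A (by rw [hN] at hN4; exact_mod_cast hN4)
    (M := N ^ (1 + δ) / 16) (by linarith) (by rw [← hN, div_pow]; linarith) (by positivity)
  by_contra! hcon
  set s : ℝ := (({z : F | ∃ x ∈ boundedProducts A 20, ∃ y ∈ boundedProducts A 20,
            z = (a₁ : F) * ((x : F) * (y : F) + (x : F)⁻¹ * (y : F)⁻¹) +
              (a₂ : F) * ((x : F)⁻¹ * (y : F) + (x : F) * (y : F)⁻¹)}.ncard : ℕ) : ℝ)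
  have hs : s ^ 12 ≤ N ^ (12 + δ / 2) := by
    calc s ^ 12 ≤ (N ^ (1 + δ / 24)) ^ 12 := pow_le_pow_left₀ (Nat.cast_nonneg _) hcon 12
      _ = N ^ (12 + δ / 2) := by
        rw [← Real.rpow_natCast, ← Real.rpow_mul hNpos.le]
        congr 1
        push_cast
        ring
  have hhalf : (2 : ℝ) ^ (28 : ℕ) < N ^ (δ / 2) := by
    calc (2 : ℝ) ^ (28 : ℕ) = ((2 : ℝ) ^ (56 / δ)) ^ (δ / 2) := by
          rw [← Real.rpow_mul zero_le_two, ← Real.rpow_natCast]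
          congr 1
          push_cast
          field_simp
          norm_num
      _ < N ^ (δ / 2) := Real.rpow_lt_rpow (by positivity) hC (by positivity)
  have hsplit : N ^ (1 + δ) * N ^ 11 = N ^ (12 + δ / 2) * N ^ (δ / 2) := by
    rw [← Real.rpow_natCast, ← Real.rpow_add hNpos, ← Real.rpow_add hNpos]
    congr 1
    push_cast
    ring
  have hlow : N ^ (12 + δ / 2) * N ^ (δ / 2) ≤ 2 ^ 27 * N ^ (12 + δ / 2) := by
    rw [← hsplit]
    rw [← hN] at hgrowth
    calc N ^ (1 + δ) * N ^ 11 = 16 * 4 ^ 11 * (N ^ (1 + δ) / 16 * (N / 4) ^ 11) := by ring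
      _ ≤ 16 * 4 ^ 11 * (2 * N ^ (12 + δ / 2)) := 
        mul_le_mul_of_nonneg_left (by linarith) (by norm_num)
      _ = 2 ^ 27 * N ^ (12 + δ / 2) := by ring
  have hZ : 0 < N ^ (12 + δ / 2) := by positivity
  have := mul_lt_mul_of_pos_left hhalf hZ
  linarith
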